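/- Let $G$ be a rigidity circuit, that is, a finite simple graph with at least one edge such that removing any single edge gives a Laman graph (a graph with $n$ vertices and exactly $2n-3$ edges in which every set of $k\ge 2$ vertices spans at most $2k-3$ edges). Let $G$ be given as a plane graph: a system of rotations (a counter-clockwise cyclic order of the edges at each vertex) of the connected graph $G$ whose facial structure is that of an embedding in the sphere, i.e. satisfies $|V|-|E|+|F|=2$, together with an arbitrary face $f_o$ prescribed as the outer face. The other faces are called interior. Let $v_0$ be an arbitrary prescribed vertex that is not incident to $f_o$. Let $H$ be the bipartite graph with sides $V\setminus\{v_0\}$ and $W$, where $W$ contains $d_f-3$ copies of each interior face $f$ and $d_{f_o}$ copies of $f_o$ ($d_f$ denotes the number of edges of the face $f$), and where a vertex is adjacent in $H$ to every copy of every face to which it is incident. Then: 1. $H$ has a perfect matching. 2. $G$ has a pointed-plus-one combinatorial pseudo-triangulation with outer face $f_o$ and non-pointed vertex $v_0$. That is, the angles of $G$ (pairs of consecutive edges at a vertex, each lying in one face) can be labeled big or small so that every interior face has exactly three small angles, all angles of the outer face are big, each vertex is incident to at most one big angle, every vertex of degree $2$ is incident to a big angle, and $v_0$ is the only vertex incident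 to no big angle. -/

import Mathlib

/-!
Plane graphs as rotation systems of genus zero with a chosen outer face, Laman graphs and
rigidity circuits by counts, combinatorial pseudo-triangulations, and the bipartite graph whose
perfect matchings describe the possible assignments of big angles.
-/

universe u

namespace PseudoTri

/-! ### Laman graphs and rigidity circuits -/

section Rigidity

variable {V : Type u}

/-- The edges of `G` spanned by a set `S` of vertices. -/
def spannedEdges (G : SimpleGraph V) (S : Set V) : Set (Sym2 V) :=
  {e | e ∈ G.edgeSet ∧ ∀ v ∈ e, v ∈ S}

/-- `G` is a Laman graph: `m = 2 n - 3`, and every set of `k ≥ 2` vertices spans at most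
`2 k - 3` edges (both written without subtraction). -/
def IsLaman (G : SimpleGraph V) : Prop :=
  G.edgeSet.ncard + 3 = 2 * Nat.card V ∧
    ∀ S : Set V, 2 ≤ S.ncard → (spannedEdges G S).ncard + 3 ≤ 2 * S.ncard

/-- `G` is a rigidity circuit: it has an edge, and removing any edge gives a Laman graph. -/
def IsRigidityCircuit (G : SimpleGraph V) : Prop :=
  G.edgeSet.Nonempty ∧ ∀ e ∈ G.edgeSet, IsLaman (G.deleteEdges {e})

end Rigidity

/-! ### Rotation systems, faces, sphere embeddings -/

section Embedding

variable {V : Type u}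

/-- A system of rotations on `G`: for each vertex a cyclic (counter-clockwise) order of the edges
incident to it.  An edge incident to `v` is recorded as the dart (oriented edge) starting at `v`,
and `rot d` is the dart that follows `d` around its starting point `d.fst`. -/
structure RotationSystem (G : SimpleGraph V) where
  /-- the successor in counter-clockwise order around the starting point -/
  rot : Equiv.Perm G.Dart
  rot_fst : ∀ d : G.Dart, (rot d).fst = d.fst
  rot_sameCycle : ∀ d d' : G.Dart, d.fst = d'.fst → rot.SameCycle d d'

namespace RotationSystem

variable {G : SimpleGraph V} (R : RotationSystem G)

/-- The next dart along the boundary of the face on the left of a dart `u → v`: the one that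
precedes `v → u` in the counter-clockwise order around `v`. -/
def facePerm : Equiv.Perm G.Dart :=
  R.rot⁻¹ * (SimpleGraph.Dart.symm_involutive (G := G)).toPerm

/-- The faces: the orbits of the face-tracing permutation. -/
def Face : Type u := Quotient (Equiv.Perm.SameCycle.setoid R.facePerm)

/-- The face on the left of a dart.  An angle is a pair `(d, rot d)` of consecutive edges at a
vertex; it is represented by its first dart `d`.  It lies at the vertex `d.fst` and in the face
`R.face d`. -/
def face (d : G.Dart) : R.Face := Quotient.mk _ d

/-- The degree of a face: the length of its boundary walk. -/
noncomputable def faceDegree (f : R.Face) : ℕ := {d : G.Dart | R.face d = f}.ncard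

/-- The vertex `v` belongs to the face `f`. -/
def Incident (v : V) (f : R.Face) : Prop := ∃ d : G.Dart, d.fst = v ∧ R.face d = f

end RotationSystem

/-- A sphere embedding of a connected graph: a system of rotations of genus zero, that is, one
whose facial structure satisfies Euler's relation `|V| - |E| + |F| = 2`.  Together with the choice
of a face as the outer face it is a plane graph. -/
structure SphereEmbedding (G : SimpleGraph V) extends RotationSystem G where
  connected : G.Connected
  euler : Nat.card V + Nat.card toRotationSystem.Face = G.edgeSet.ncard + 2

end Embedding

/-! ### Combinatorial pseudo-triangulations -/

/-- The two labels of angles: big (reflex) and small (convex). -/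
inductive AngleLabel : Type
  | big
  | small

section CPT

variable {V : Type u} {G : SimpleGraph V}

/-- A vertex is pointed if it is incident to an angle labeled big. -/
def IsPointed (L : G.Dart → AngleLabel) (v : V) : Prop :=
  ∃ d : G.Dart, d.fst = v ∧ L d = AngleLabel.big

/-- The labeling `L` of the angles is a combinatorial pseudo-triangulation of the plane graph
given by `R` and the outer face `outer`. -/
structure IsCPT (R : RotationSystem G) (outer : R.Face) (L : G.Dart → AngleLabel) : Prop where
  /-- every face except the outer one has exactly three small angles -/
  three_corners : ∀ f : R.Face, f ≠ outer →
    {d : G.Dart | R.face d = f ∧ L d = AngleLabel.small}.ncard = 3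
  /-- all angles of the outer face are big -/
  outer_big : ∀ d : G.Dart, R.face d = outer → L d = AngleLabel.big
  /-- each vertex is incident to at most one big angle -/
  big_unique : ∀ d d' : G.Dart, d.fst = d'.fst →
    L d = AngleLabel.big → L d' = AngleLabel.big → d = d'
  /-- a vertex of degree two is incident to a big angle -/
  pointed_of_degree_two : ∀ v : V, (G.neighborSet v).ncard = 2 → IsPointed L v

/-- A combinatorial pseudo-triangulation is pointed-plus-one if exactly one vertex is
non-pointed. -/
def IsPointedPlusOneCPT (R : RotationSystem G) (outer : R.Face) (L : G.Dart → AngleLabel) :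
    Prop :=
  IsCPT R outer L ∧ ∃! v : V, ¬ IsPointed L v

/-! ### The associated bipartite graph -/

open Classical in
/-- The multiplicity of a face in `W`: its degree `d` for the outer face, and `d - 3` for an
interior face. -/
noncomputable def faceMultiplicity (R : RotationSystem G) (outer f : R.Face) : ℕ :=
  if f = outer then R.faceDegree f else R.faceDegree f - 3

/-- The side `W` of the bipartition: each face, taken with its multiplicity. -/
abbrev FaceCopy (R : RotationSystem G) (outer : R.Face) : Type u :=
  Σ f : R.Face, Fin (faceMultiplicity R outer f)

/-- The bipartite graph `H` with sides `V \ {v₀}` and `W`: a vertex is joined to all copies of the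
faces to which it belongs. -/
def bipartiteH (R : RotationSystem G) (outer : R.Face) (v₀ : V) :
    SimpleGraph ({v : V // v ≠ v₀} ⊕ FaceCopy R outer) where
  Adj
    | Sum.inl v, Sum.inr w => R.Incident v.1 w.1
    | Sum.inr w, Sum.inl v => R.Incident v.1 w.1
    | Sum.inl _, Sum.inl _ => False
    | Sum.inr _, Sum.inr _ => False
  symm := ⟨by rintro (_ | _) (_ | _) h <;> exact h⟩
  loopless := ⟨by rintro (_ | _) h <;> exact h⟩

end CPT

end PseudoTri

namespace PseudoTri

/-! A perfect matching of `H` chooses at each vertex other than `v₀` one incident face, hence one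
angle to label big. The multiplicities then leave three small angles in each interior face and none
in the outer one, so everything reduces to Hall's condition for vertices against face copies.

A circuit has 2n - 2 edges, so Euler's relation gives n faces and both sides of `H` have n - 1
elements; genus zero enters only here. The faces around a set of vertices split into classes
connected across edges, and the faces around one vertex lie in a single class. So it suffices to
treat a dual-connected set `C` and the vertices it surrounds
(`ncard_interiorVerts_le_sum_faceMultiplicity`).

Let I, E, b count the interior vertices, interior edges and boundary darts of `C`. Then: - the face
degrees sum to 2E + b; - E + b edges are spanned by at most I + b vertices, so sparsity gives E + 3
≤ 2I + b unless `C` meets every edge; - if `C` omits a face, |C| + I ≤ E + 1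
(`ncard_add_ncard_interiorVerts_le`). Hence 2E + b - 3|C| ≥ 3I + b - E - 3 ≥ I. If `C` meets every
edge, the exact edge count replaces sparsity, and the exclusion of `v₀` supplies the one missing
unit.

The third bound replaces a topological argument by linear algebra: vertex and face potentials have
orthogonal differences. -/

instance finite_dart {V : Type u} [Finite V] (G : SimpleGraph V) : Finite G.Dart :=
  Finite.of_injective (fun d => d.toProd) (SimpleGraph.Dart.toProd_injective)

/-! ### Faces, potentials and the bound for dual-connected sets of faces -/

namespace RotationSystem

variable {V : Type u} {G : SimpleGraph V} (R : RotationSystem G)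

instance finite_face [Finite V] : Finite R.Face :=
  Quotient.finite (Equiv.Perm.SameCycle.setoid R.facePerm)

theorem facePerm_apply (d : G.Dart) : R.facePerm d = R.rot.symm d.symm := rfl

theorem rot_facePerm (d : G.Dart) : R.rot (R.facePerm d) = d.symm := by
  simp [facePerm_apply]

theorem facePerm_fst (d : G.Dart) : (R.facePerm d).fst = d.snd := by
  rw [← R.rot_fst (R.facePerm d), rot_facePerm]; rfl

theorem face_eq_iff {d d' : G.Dart} :
    R.face d = R.face d' ↔ R.facePerm.SameCycle d d' :=
  ⟨fun h => Quotient.exact h, fun h => Quotient.sound h⟩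

theorem face_surjective (f : R.Face) : ∃ d, R.face d = f := Quotient.exists_rep f

theorem face_facePerm (d : G.Dart) : R.face (R.facePerm d) = R.face d :=
  R.face_eq_iff.2 (Equiv.Perm.sameCycle_apply_left.2 (Equiv.Perm.SameCycle.refl _ _))

theorem face_rot_symm (d : G.Dart) : R.face (R.rot d).symm = R.face d := by
  have h : R.facePerm (R.rot d).symm = d := by
    rw [facePerm_apply, SimpleGraph.Dart.symm_symm, Equiv.symm_apply_apply]
  rw [← R.face_facePerm (R.rot d).symm, h]

/-- A property of darts preserved by rotation spreads to all darts at the same vertex. -/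
theorem rot_induction [Finite V] {P : G.Dart → Prop} (hP : ∀ d, P d → P (R.rot d))
    {d d' : G.Dart} (h : d.fst = d'.fst) (hd : P d) : P d' := by
  obtain ⟨i, rfl⟩ := (R.rot_sameCycle d d' h).exists_nat_pow_eq
  induction i with
  | zero => simpa using hd
  | succ n ih =>
    rw [pow_succ', Equiv.Perm.mul_apply]
    exact hP _ (ih (by rw [h, pow_succ', Equiv.Perm.mul_apply, R.rot_fst]))

/-- A set of faces is dual-connected if its faces can be reached from one another by crossing edges
both sides of which lie in the set. -/
def DualConnected (C : Set R.Face) : Prop :=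
  ∀ P : R.Face → Prop,
    (∀ d, R.face d ∈ C → R.face d.symm ∈ C → P (R.face d) → P (R.face d.symm)) →
      ∀ f ∈ C, ∀ g ∈ C, P f → P g

/-- The vertices all of whose faces lie in `C`. -/
def interiorVerts (C : Set R.Face) : Set V := {v | ∀ d : G.Dart, d.fst = v → R.face d ∈ C}

/-- The vertices incident to some face in `C`. -/
def vertsOf (C : Set R.Face) : Set V := {v | ∃ d : G.Dart, d.fst = v ∧ R.face d ∈ C}

/-- The edges on the boundary of some face in `C`. -/
def edgesOf (C : Set R.Face) : Set (Sym2 V) := {e | ∃ d : G.Dart, d.edge = e ∧ R.face d ∈ C}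

/-- The edges both sides of which lie in `C`. -/
def interiorEdges (C : Set R.Face) : Set (Sym2 V) :=
  {e | ∃ d : G.Dart, d.edge = e ∧ R.face d ∈ C ∧ R.face d.symm ∈ C}

/-- The darts with a face of `C` on the left and a face outside `C` on the right. -/
def boundaryDarts (C : Set R.Face) : Set G.Dart :=
  {d | R.face d ∈ C ∧ R.face d.symm ∉ C}

/-- Differences of vertex potentials are orthogonal to differences of face potentials. -/
theorem sum_vertex_diff_mul_face_diff [Fintype G.Dart] (p : V → ℝ) (c : R.Face → ℝ) :
    ∑ d : G.Dart, (p d.fst - p d.snd) * (c (R.face d) - c (R.face d.symm)) = 0 := by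
  have hsymm : ∀ F : G.Dart → ℝ, ∑ d : G.Dart, F d.symm = ∑ d, F d := fun F =>
    Equiv.sum_comp (SimpleGraph.Dart.symm_involutive (G := G)).toPerm F
  -- Around a vertex, the faces to the right of its darts are those to the left, shifted by one
  -- rotation step.
  have hrot : ∑ d : G.Dart, p d.fst * c (R.face d.symm) = ∑ d : G.Dart, p d.fst * c (R.face d) := by
    rw [← Equiv.sum_comp R.rot]
    exact Finset.sum_congr rfl fun d _ => by rw [R.rot_fst, R.face_rot_symm]
  have h1 := hsymm fun d => p d.fst * c (R.face d)
  have h2 := hsymm fun d => p d.fst * c (R.face d.symm)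
  simp only [SimpleGraph.Dart.symm_symm] at h1 h2
  have e : ∀ d : G.Dart, (p d.fst - p d.snd) * (c (R.face d) - c (R.face d.symm)) =
      p d.fst * c (R.face d) - p d.fst * c (R.face d.symm)
        - p d.symm.fst * c (R.face d) + p d.symm.fst * c (R.face d.symm) := fun d => by
    have : d.symm.fst = d.snd := rfl
    rw [this]; ring
  simp only [e, Finset.sum_add_distrib, Finset.sum_sub_distrib]
  linarith

theorem mem_of_fst_mem_interiorVerts {C : Set R.Face} {d : G.Dart}
    (h : d.fst ∈ R.interiorVerts C) : R.face d ∈ C ∧ R.face d.symm ∈ C := by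
  refine ⟨h d rfl, ?_⟩
  have h1 := h (R.rot.symm d) (by rw [← R.rot_fst, Equiv.apply_symm_apply])
  rwa [← R.face_rot_symm, Equiv.apply_symm_apply] at h1

/-- A discrete Cauchy–Riemann argument. On interior edges the two differences are opposite; on all
other edges the vertex difference vanishes, as neither end is interior. Orthogonality therefore
makes the sum of squares of the vertex differences zero. Thus `p` is constant, and zero at a vertex
of `f₁`; then `c` is constant on `C`, and zero at `f₀`. -/
theorem potentials_eq_zero [Finite V] (hc : G.Preconnected) {C : Set R.Face}
    (hC : R.DualConnected C) {f₀ f₁ : R.Face} (hf₀ : f₀ ∈ C) (hf₁ : f₁ ∉ C)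
    (p : V → ℝ) (c : R.Face → ℝ) (hp : ∀ v ∉ R.interiorVerts C, p v = 0)
    (hcs : ∀ f ∉ C, c f = 0) (hc₀ : c f₀ = 0)
    (h : ∀ d : G.Dart, R.face d ∈ C → R.face d.symm ∈ C →
      c (R.face d) - c (R.face d.symm) + (p d.fst - p d.snd) = 0) :
    p = 0 ∧ c = 0 := by
  classical
  have := Fintype.ofFinite G.Dart
  have hsq : ∀ d : G.Dart, (p d.fst - p d.snd) ^ 2 =
      -((p d.fst - p d.snd) * (c (R.face d) - c (R.face d.symm))) := by
    intro d
    by_cases hd : R.face d ∈ C ∧ R.face d.symm ∈ C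
    · have := h d hd.1 hd.2
      have h2 : c (R.face d) - c (R.face d.symm) = -(p d.fst - p d.snd) := by linarith
      rw [h2]; ring
    · have h1 : p d.fst = 0 := hp _ fun hm => hd (R.mem_of_fst_mem_interiorVerts hm)
      have h2 : p d.snd = 0 := hp _ fun hm => hd (by
        have := R.mem_of_fst_mem_interiorVerts (d := d.symm) hm
        rw [SimpleGraph.Dart.symm_symm] at this
        exact this.symm)
      simp [h1, h2]
  have hsum : ∑ d : G.Dart, (p d.fst - p d.snd) ^ 2 = 0 := by
    rw [Finset.sum_congr rfl fun d _ => hsq d, Finset.sum_neg_distrib,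
      R.sum_vertex_diff_mul_face_diff, neg_zero]
  have hz : ∀ d : G.Dart, p d.fst = p d.snd := fun d => by
    have := (Finset.sum_eq_zero_iff_of_nonneg fun d _ => sq_nonneg _).1 hsum d (Finset.mem_univ _)
    exact sub_eq_zero.1 (pow_eq_zero_iff two_ne_zero |>.1 this)
  have hconst : ∀ v w : V, p v = p w := by
    intro v w
    obtain ⟨q⟩ := hc v w
    induction q with
    | nil => rfl
    | cons hadj q ih => exact (hz ⟨(_, _), hadj⟩).trans ih
  obtain ⟨d₁, hd₁⟩ := R.face_surjective f₁
  have hout : p d₁.fst = 0 := hp _ fun hm => hf₁ (hd₁ ▸ hm d₁ rfl)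
  refine ⟨funext fun v => (hconst v d₁.fst).trans hout, funext fun f => ?_⟩
  by_cases hf : f ∈ C
  · refine hC (fun g => c g = 0) (fun d h1 h2 h3 => ?_) f₀ hf₀ f hf hc₀
    have := h d h1 h2
    have h4 := hz d
    linarith
  · exact hcs f hf

/-- For a dual-connected proper set of faces, faces plus interior vertices exceed interior edges
by at most one. -/
theorem ncard_add_ncard_interiorVerts_le [Finite V] (hc : G.Preconnected) {C : Set R.Face}
    (hC : R.DualConnected C) {f₀ f₁ : R.Face} (hf₀ : f₀ ∈ C) (hf₁ : f₁ ∉ C) :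
    C.ncard + (R.interiorVerts C).ncard ≤ (R.interiorEdges C).ncard + 1 := by
  classical
  -- Dropping `f₀` fixes the additive constant of the face potential; this is the `+ 1` in the
  -- bound.
  let C' : Set R.Face := C \ {f₀}
  let I := R.interiorVerts C
  let E := R.interiorEdges C
  have := Fintype.ofFinite C'
  have := Fintype.ofFinite I
  have := Fintype.ofFinite E
  -- An arbitrary orientation of each interior edge; reversing it only changes the sign of that
  -- coordinate of `Φ`.
  choose δ hδ using fun e : E => e.2
  let xc : (C' → ℝ) →ₗ[ℝ] (R.Face → ℝ) := Function.ExtendByZero.linearMap ℝ Subtype.val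
  let xp : (I → ℝ) →ₗ[ℝ] (V → ℝ) := Function.ExtendByZero.linearMap ℝ Subtype.val
  let Φ : ((C' → ℝ) × (I → ℝ)) →ₗ[ℝ] (E → ℝ) := LinearMap.pi fun e =>
    ((LinearMap.proj (R.face (δ e)) : (R.Face → ℝ) →ₗ[ℝ] ℝ) -
          (LinearMap.proj (R.face (δ e).symm) : (R.Face → ℝ) →ₗ[ℝ] ℝ)) ∘ₗ xc ∘ₗ
        LinearMap.fst ℝ (C' → ℝ) (I → ℝ) +
      ((LinearMap.proj (δ e).fst : (V → ℝ) →ₗ[ℝ] ℝ) -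
          (LinearMap.proj (δ e).snd : (V → ℝ) →ₗ[ℝ] ℝ)) ∘ₗ xp ∘ₗ
        LinearMap.snd ℝ (C' → ℝ) (I → ℝ)
  have hΦ : Function.Injective Φ := by
    rw [injective_iff_map_eq_zero]
    rintro ⟨c, p⟩ h0
    have hxc : ∀ f ∉ C', xc c f = 0 := fun f hf =>
      Function.extend_apply' _ _ _ fun ⟨a, ha⟩ => hf (ha ▸ a.2)
    have hxp : ∀ v ∉ I, xp p v = 0 := fun f hf =>
      Function.extend_apply' _ _ _ fun ⟨a, ha⟩ => hf (ha ▸ a.2)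
    obtain ⟨h1, h2⟩ := R.potentials_eq_zero hc hC hf₀ hf₁ (xp p) (xc c) hxp
      (fun f hf => hxc f fun h => hf h.1) (hxc f₀ fun h => h.2 rfl) (by
        intro d hd hd'
        let e : E := ⟨d.edge, d, rfl, hd, hd'⟩
        have h3 : xc c (R.face (δ e)) - xc c (R.face (δ e).symm) +
          (xp p (δ e).fst - xp p (δ e).snd) = 0 := congrFun h0 e
        rcases (SimpleGraph.dart_edge_eq_iff _ _).1 (hδ e).1 with h4 | h4
        · rwa [h4] at h3
        · rw [h4, SimpleGraph.Dart.symm_symm] at h3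
          have h5 : d.symm.fst = d.snd := rfl
          have h6 : d.symm.snd = d.fst := rfl
          rw [h5, h6] at h3
          linarith)
    refine Prod.ext (funext fun a => ?_) (funext fun a => ?_)
    · exact (Subtype.val_injective.extend_apply c 0 a).symm.trans (congrFun h2 a.1)
    · exact (Subtype.val_injective.extend_apply p 0 a).symm.trans (congrFun h1 a.1)
  have hle := LinearMap.finrank_le_finrank_of_injective hΦ
  rw [Module.finrank_prod, Module.finrank_pi, Module.finrank_pi, Module.finrank_pi,
    ← Nat.card_eq_fintype_card, ← Nat.card_eq_fintype_card, ← Nat.card_eq_fintype_card,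
    Nat.card_coe_set_eq, Nat.card_coe_set_eq, Nat.card_coe_set_eq] at hle
  have hcard : C'.ncard + 1 = C.ncard := Set.ncard_sdiff_singleton_add_one hf₀ (Set.toFinite C)
  change C.ncard + I.ncard ≤ E.ncard + 1
  omega

/-! ### Counting darts, edges and vertices of a set of faces -/

theorem ncard_darts_of_edges [Finite V] {S : Set (Sym2 V)} (hS : S ⊆ G.edgeSet) :
    {d : G.Dart | d.edge ∈ S}.ncard = 2 * S.ncard := by
  classical
  have := Fintype.ofFinite V
  rw [Set.ncard_eq_toFinset_card', Set.ncard_eq_toFinset_card',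
    Finset.card_eq_sum_card_fiberwise (f := fun d : G.Dart => d.edge) (t := S.toFinset)
      (fun d hd => by simpa using hd), mul_comm, ← smul_eq_mul, ← Finset.sum_const]
  refine Finset.sum_congr rfl fun e he => ?_
  have he' : e ∈ S := by simpa using he
  rw [← G.dart_edge_fiber_card e (hS he')]
  congr 1
  ext d
  simp only [Finset.mem_filter, Set.mem_toFinset, Set.mem_ofPred_eq, Finset.mem_univ, true_and]
  exact ⟨fun h => h.2, fun h => ⟨h ▸ he', h⟩⟩

theorem edgesOf_subset (C : Set R.Face) : R.edgesOf C ⊆ G.edgeSet := by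
  rintro _ ⟨d, rfl, -⟩; exact d.edge_mem

theorem interiorEdges_subset (C : Set R.Face) : R.interiorEdges C ⊆ G.edgeSet := by
  rintro _ ⟨d, rfl, -⟩; exact d.edge_mem

theorem edge_mem_edgesOf {C : Set R.Face} {d : G.Dart} :
    d.edge ∈ R.edgesOf C ↔ R.face d ∈ C ∨ R.face d.symm ∈ C := by
  constructor
  · rintro ⟨d', h, hd'⟩
    rcases (SimpleGraph.dart_edge_eq_iff _ _).1 h with rfl | rfl
    · exact Or.inl hd'
    · exact Or.inr hd'
  · rintro (h | h)
    · exact ⟨d, rfl, h⟩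
    · exact ⟨d.symm, d.edge_symm, h⟩

theorem edge_mem_interiorEdges {C : Set R.Face} {d : G.Dart} :
    d.edge ∈ R.interiorEdges C ↔ R.face d ∈ C ∧ R.face d.symm ∈ C := by
  constructor
  · rintro ⟨d', h, hd'⟩
    rcases (SimpleGraph.dart_edge_eq_iff _ _).1 h with rfl | rfl
    · exact hd'
    · rw [SimpleGraph.Dart.symm_symm] at hd'
      exact hd'.symm
  · exact fun h => ⟨d, rfl, h⟩

theorem ncard_face_mem [Finite V] (C : Set R.Face) :
    {d : G.Dart | R.face d ∈ C}.ncard =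
      2 * (R.interiorEdges C).ncard + (R.boundaryDarts C).ncard := by
  rw [← ncard_darts_of_edges (R.interiorEdges_subset C), ← Set.ncard_union_eq]
  · congr 1
    ext d
    simp only [Set.mem_ofPred_eq, Set.mem_union, edge_mem_interiorEdges, boundaryDarts]
    tauto
  · rw [Set.disjoint_left]
    intro d hd hd'
    exact hd'.2 (R.edge_mem_interiorEdges.1 hd).2

theorem ncard_edgesOf [Finite V] (C : Set R.Face) :
    (R.edgesOf C).ncard = (R.interiorEdges C).ncard + (R.boundaryDarts C).ncard := by
  have h1 := ncard_darts_of_edges (R.edgesOf_subset C)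
  have h2 := R.ncard_face_mem C
  have h3 : {d : G.Dart | d.edge ∈ R.edgesOf C} =
      {d : G.Dart | R.face d ∈ C} ∪ SimpleGraph.Dart.symm '' R.boundaryDarts C := by
    ext d
    simp only [Set.mem_ofPred_eq, Set.mem_union, edge_mem_edgesOf, Set.mem_image, boundaryDarts]
    constructor
    · rintro (h | h)
      · exact Or.inl h
      · by_cases h' : R.face d ∈ C
        · exact Or.inl h'
        · exact Or.inr ⟨d.symm, ⟨h, by rwa [SimpleGraph.Dart.symm_symm]⟩, d.symm_symm⟩
    · rintro (h | ⟨e, ⟨h, -⟩, rfl⟩)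
      · exact Or.inl h
      · exact Or.inr (by rwa [SimpleGraph.Dart.symm_symm])
  rw [h3, Set.ncard_union_eq, Set.ncard_image_of_injective _
    SimpleGraph.Dart.symm_involutive.injective] at h1
  · omega
  · rw [Set.disjoint_left]
    rintro _ hd ⟨e, he, rfl⟩
    exact he.2 hd

/-- A vertex with angles both inside and outside `C` starts a boundary dart: rotating from an
outside angle, the first dart whose left face is in `C` has a face outside `C` on its right. -/
theorem ncard_vertsOf_le [Finite V] (C : Set R.Face) :
    (R.vertsOf C).ncard ≤ (R.interiorVerts C).ncard + (R.boundaryDarts C).ncard := by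
  have hsub : R.vertsOf C ⊆ R.interiorVerts C ∪
      (fun d : G.Dart => d.fst) '' R.boundaryDarts C := by
    rintro v ⟨d, rfl, hd⟩
    by_contra hv
    rw [Set.mem_union, not_or] at hv
    obtain ⟨hI, hB⟩ := hv
    apply hI
    intro d' hd'
    by_contra hout
    refine R.rot_induction (P := fun e => e.fst = d.fst → R.face e ∉ C)
      (fun e he hfst hmem => ?_) hd' (fun _ => hout) rfl hd
    refine hB ⟨R.rot e, ⟨hmem, ?_⟩, hfst⟩
    rw [R.face_rot_symm]
    exact he ((R.rot_fst e).symm.trans hfst)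
  refine (Set.ncard_le_ncard hsub (Set.toFinite _)).trans ((Set.ncard_union_le _ _).trans ?_)
  exact Nat.add_le_add_left (Set.ncard_image_le (Set.toFinite _)) _

theorem sum_faceDegree [Finite V] (C : Finset R.Face) :
    ∑ f ∈ C, R.faceDegree f = {d : G.Dart | R.face d ∈ C}.ncard := by
  classical
  have := Fintype.ofFinite V
  rw [Set.ncard_eq_toFinset_card',
    Finset.card_eq_sum_card_fiberwise (f := R.face) (t := C) (fun d hd => by simpa using hd)]
  refine Finset.sum_congr rfl fun f hf => ?_
  rw [faceDegree, Set.ncard_eq_toFinset_card']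
  congr 1
  ext d
  simp only [Finset.mem_filter, Set.mem_toFinset, Set.mem_ofPred_eq]
  exact ⟨fun h => ⟨h ▸ hf, h⟩, fun h => h.2⟩

theorem edgesOf_subset_spannedEdges (C : Set R.Face) :
    R.edgesOf C ⊆ spannedEdges G (R.vertsOf C) := by
  rintro _ ⟨d, rfl, hd⟩
  refine ⟨d.edge_mem, fun v hv => ?_⟩
  have hv' : v = d.fst ∨ v = d.snd := by
    have : d.edge = s(d.fst, d.snd) := rfl
    rwa [this, Sym2.mem_iff] at hv
  rcases hv' with rfl | rfl
  · exact ⟨d, rfl, hd⟩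
  · exact ⟨R.facePerm d, R.facePerm_fst d, by rwa [R.face_facePerm]⟩

end RotationSystem
-- Edge counts, minimum degree and face degrees in rigidity circuits
namespace IsRigidityCircuit

variable {V : Type u} [Finite V] {G : SimpleGraph V}

theorem ncard_edgeSet (hG : IsRigidityCircuit G) : G.edgeSet.ncard + 2 = 2 * Nat.card V := by
  obtain ⟨e, he⟩ := hG.1
  have h := (hG.2 e he).1
  rw [SimpleGraph.edgeSet_deleteEdges] at h
  have := Set.ncard_sdiff_singleton_add_one he (Set.toFinite G.edgeSet)
  omega

theorem ncard_le_of_subset_spannedEdges (hG : IsRigidityCircuit G) {T : Set (Sym2 V)} {S : Set V}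
    (hT : T ⊆ spannedEdges G S) (hne : T ≠ G.edgeSet) (hS : 2 ≤ S.ncard) :
    T.ncard + 3 ≤ 2 * S.ncard := by
  obtain ⟨e, he, heT⟩ : ∃ e ∈ G.edgeSet, e ∉ T := by
    by_contra! h
    exact hne (Set.Subset.antisymm (fun e he => (hT he).1) h)
  refine le_trans (Nat.add_le_add_right (Set.ncard_le_ncard ?_ (Set.toFinite _)) 3)
    ((hG.2 e he).2 S hS)
  intro e' he'
  refine ⟨?_, (hT he').2⟩
  rw [SimpleGraph.edgeSet_deleteEdges]
  exact ⟨(hT he').1, fun h => heT (h ▸ he')⟩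

theorem three_le_card (hG : IsRigidityCircuit G) : 3 ≤ Nat.card V := by
  classical
  have := Fintype.ofFinite V
  have h1 := hG.ncard_edgeSet
  have h2 := G.card_edgeFinset_le_card_choose_two
  have h3 := (Set.ncard_pos (Set.toFinite _)).2 hG.1
  rw [← Nat.card_eq_fintype_card, SimpleGraph.edgeFinset, ← Set.ncard_eq_toFinset_card'] at h2
  by_contra! hlt
  generalize Nat.card V = n at *
  interval_cases n
  · omega
  · omega
  · rw [Nat.choose_self] at h2; omega

theorem exists_dart (hG : IsRigidityCircuit G) (hc : G.Connected) (v : V) :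
    ∃ d : G.Dart, d.fst = v := by
  have : Nontrivial V := Finite.one_lt_card_iff_nontrivial.1 (by have := hG.three_le_card; omega)
  obtain ⟨w, hw⟩ := hc.preconnected.exists_adj_of_nontrivial v
  exact ⟨⟨(v, w), hw⟩, rfl⟩

/-- The other n - 1 vertices span at most 2(n - 1) - 3 of the 2n - 2 edges, so at least three edges
meet `v`. -/
theorem three_le_ncard_neighborSet (hG : IsRigidityCircuit G) (hc : G.Connected) (v : V) :
    3 ≤ (G.neighborSet v).ncard := by
  have hcard := hG.three_le_card
  have hcompl : ({v}ᶜ : Set V).ncard = Nat.card V - 1 := by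
    rw [Set.ncard_compl, Set.ncard_singleton]
  obtain ⟨d, rfl⟩ := hG.exists_dart hc v
  have h1 : (spannedEdges G {d.fst}ᶜ).ncard + 3 ≤ 2 * ({d.fst}ᶜ : Set V).ncard := by
    refine hG.ncard_le_of_subset_spannedEdges subset_rfl (fun h => ?_) (by omega)
    exact (h.symm ▸ d.edge_mem : d.edge ∈ spannedEdges G {d.fst}ᶜ).2 d.fst
      (Sym2.mem_mk_left _ _) rfl
  have h2 : G.edgeSet ⊆ spannedEdges G {d.fst}ᶜ ∪
      (fun w => s(d.fst, w)) '' G.neighborSet d.fst := by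
    intro e he
    by_cases hv : d.fst ∈ e
    · obtain ⟨w, rfl⟩ := hv
      exact Or.inr ⟨w, he, rfl⟩
    · exact Or.inl ⟨he, fun w hw h => hv (h ▸ hw)⟩
  have h3 := Set.ncard_le_ncard h2 (Set.toFinite _)
  have h4 := Set.ncard_union_le (spannedEdges G {d.fst}ᶜ)
    ((fun w => s(d.fst, w)) '' G.neighborSet d.fst)
  have h5 := Set.ncard_image_le (f := fun w => s(d.fst, w)) (Set.toFinite (G.neighborSet d.fst))
  have h6 := hG.ncard_edgeSet
  omega

/-- Needed so that the natural subtraction in `faceMultiplicity` is not truncated. A face walk of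
period one would be a loop, and one of period two would turn back at a vertex of degree one. -/
theorem three_le_faceDegree (hG : IsRigidityCircuit G) (hc : G.Connected) (R : RotationSystem G)
    (f : R.Face) : 3 ≤ R.faceDegree f := by
  obtain ⟨d, rfl⟩ := R.face_surjective f
  have hne : ∀ e : G.Dart, e ≠ R.facePerm e := fun e h =>
    e.adj.ne ((congrArg (fun e : G.Dart => e.fst) h).trans (R.facePerm_fst e))
  have hne2 : d ≠ R.facePerm (R.facePerm d) := by
    intro h
    have h1 : R.facePerm d = d.symm := by
      apply SimpleGraph.Dart.ext
      refine Prod.ext (R.facePerm_fst d) ?_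
      exact (R.facePerm_fst _).symm.trans (congrArg (fun e : G.Dart => e.fst) h.symm)
    have hfix : R.rot d.symm = d.symm := by
      conv_lhs => rw [← h1]
      exact R.rot_facePerm d
    have hsub : G.neighborSet d.snd ⊆ {d.fst} := by
      intro w hw
      have := R.rot_induction (P := fun e => e = d.symm) (fun e he => by rw [he, hfix])
        (d := d.symm) (d' := ⟨(d.snd, w), hw⟩) rfl rfl
      exact congrArg (fun e : G.Dart => e.snd) this
    have h3 := Set.ncard_le_ncard hsub (Set.toFinite _)
    rw [Set.ncard_singleton] at h3
    have := hG.three_le_ncard_neighborSet hc d.snd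
    omega
  have hsub : ({d, R.facePerm d, R.facePerm (R.facePerm d)} : Set G.Dart) ⊆
      {e | R.face e = R.face d} := by
    rintro e (rfl | rfl | rfl)
    · rfl
    · exact R.face_facePerm d
    · exact (R.face_facePerm _).trans (R.face_facePerm d)
  have h := Set.ncard_le_ncard hsub (Set.toFinite _)
  rwa [Set.ncard_eq_three.2 ⟨_, _, _, hne d, hne2, hne _, rfl⟩] at h

end IsRigidityCircuit

/-! ### Hall's condition for dual-connected sets of faces -/

section Hall

variable {V : Type u} {G : SimpleGraph V}

open Classical in
theorem sum_faceDegree_le_sum_faceMultiplicity (R : RotationSystem G) (outer : R.Face)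
    (C : Finset R.Face) :
    ∑ f ∈ C, R.faceDegree f + (if outer ∈ C then 3 else 0) ≤
      ∑ f ∈ C, faceMultiplicity R outer f + 3 * C.card := by
  classical
  have h : ∀ f ∈ C, R.faceDegree f + (if f = outer then 3 else 0) ≤
      faceMultiplicity R outer f + 3 := by
    intro f _
    unfold faceMultiplicity
    split_ifs <;> omega
  have hsum := Finset.sum_le_sum h
  rw [Finset.sum_add_distrib, Finset.sum_add_distrib, Finset.sum_const, smul_eq_mul, 
    mul_comm C.card, Finset.sum_ite_eq'] at hsum
  convert hsum using 2

variable [Finite V]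

theorem SphereEmbedding.card_face (M : SphereEmbedding G) (hG : IsRigidityCircuit G) :
    Nat.card M.toRotationSystem.Face = Nat.card V := by
  have := M.euler
  have := hG.ncard_edgeSet
  omega

/-- Hall's condition for the vertices surrounded by a dual-connected set of faces. -/
theorem ncard_interiorVerts_le_sum_faceMultiplicity (R : RotationSystem G)
    (hc : G.Connected) (hF : Nat.card R.Face = Nat.card V)
    (hG : IsRigidityCircuit G) (outer : R.Face) (v₀ : V)
    (hv₀ : ¬ R.Incident v₀ outer) (C : Finset R.Face)
    (hne : C.Nonempty) (hC : R.DualConnected (C : Set R.Face)) :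
    (R.interiorVerts (C : Set R.Face) \ {v₀}).ncard ≤
      ∑ f ∈ C, faceMultiplicity R outer f := by
  classical
  have hmul := sum_faceDegree_le_sum_faceMultiplicity R outer C
  have hD := R.sum_faceDegree C
  have hD' := R.ncard_face_mem (C : Set R.Face)
  simp only [Finset.mem_coe] at hD'
  have hEo := R.ncard_edgesOf (C : Set R.Face)
  have hE := hG.ncard_edgeSet
  have hV := R.ncard_vertsOf_le (C : Set R.Face)
  have hpre := hc.preconnected
  obtain ⟨f₀, hf₀⟩ := hne
  have hkey : ∀ f₁ ∉ C, C.card + (R.interiorVerts (C : Set R.Face)).ncard ≤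
      (R.interiorEdges (C : Set R.Face)).ncard + 1 := fun f₁ hf₁ => by
    rw [← Set.ncard_coe_finset C]
    exact R.ncard_add_ncard_interiorVerts_le hpre hC (f₀ := f₀) hf₀ (f₁ := f₁)
      (by exact_mod_cast hf₁)
  have hle : (R.interiorVerts (C : Set R.Face) \ {v₀}).ncard ≤
      (R.interiorVerts (C : Set R.Face)).ncard :=
    Set.ncard_le_ncard Set.sdiff_subset (Set.toFinite _)
  -- Sparsity holds only for proper subsets of the edges, so the full edge set is counted
  -- separately.
  by_cases hall : R.edgesOf (C : Set R.Face) = G.edgeSet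
  · rw [hall] at hEo
    by_cases hproper : ∃ f₁, f₁ ∉ C
    · obtain ⟨f₁, hf₁⟩ := hproper
      have hk := hkey f₁ hf₁
      have hlt : C.card < Nat.card R.Face := by
        have := Fintype.ofFinite R.Face
        rw [Nat.card_eq_fintype_card]
        exact Finset.card_lt_univ_of_notMem hf₁
      by_cases ho : outer ∈ C
      · rw [if_pos ho] at hmul
        omega
      -- The counts give I + 2n - 3 - 2|C| as a lower bound for the multiplicities: enough if two
      -- faces are missing, short by one if only the outer face is.
      by_cases hm : C.card + 2 ≤ Nat.card R.Face
      · omega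
      have hcompl : ∀ f, f ≠ outer → f ∈ C := by
        intro f hf
        by_contra hfC
        have := Fintype.ofFinite R.Face
        have h2 : ({f, outer} : Finset R.Face) ⊆ Cᶜ := by
          intro g hg
          rcases Finset.mem_insert.1 hg with rfl | hg
          · exact Finset.mem_compl.2 hfC
          · rw [Finset.mem_singleton.1 hg]; exact Finset.mem_compl.2 ho
        have h3 := Finset.card_le_card h2
        rw [Finset.card_pair hf, Finset.card_compl, ← Nat.card_eq_fintype_card] at h3
        omega
      -- Since `v₀` is off the outer face it is surrounded by `C`, and removing it recovers the
      -- missing unit.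
      have hv₀I : v₀ ∈ R.interiorVerts (C : Set R.Face) := fun d hd =>
        hcompl _ fun h => hv₀ ⟨d, hd, h⟩
      have := Set.ncard_sdiff_singleton_add_one hv₀I (Set.toFinite _)
      omega
    · push Not at hproper
      rw [if_pos (hproper outer)] at hmul
      have hcard : C.card = Nat.card R.Face := by
        have := Fintype.ofFinite R.Face
        rw [Nat.card_eq_fintype_card, ← Finset.card_univ, Finset.eq_univ_of_forall hproper]
      have hb : (R.boundaryDarts (C : Set R.Face)).ncard = 0 := by
        rw [Set.ncard_eq_zero (Set.toFinite _), Set.eq_empty_iff_forall_notMem]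
        exact fun d hd => hd.2 (hproper _)
      have hI : (R.interiorVerts (C : Set R.Face) \ {v₀}).ncard ≤ Nat.card V - 1 := by
        rw [← Set.ncard_singleton v₀, ← Set.ncard_compl]
        exact Set.ncard_le_ncard (fun v hv => hv.2) (Set.toFinite _)
      omega
  · obtain ⟨f₁, hf₁⟩ : ∃ f₁, f₁ ∉ C := by
      by_contra! h
      refine hall (Set.Subset.antisymm (R.edgesOf_subset _) fun e he => ?_)
      induction e with
      | h v w => exact ⟨⟨(v, w), he⟩, rfl, h _⟩
    have hk := hkey f₁ hf₁
    have h2 : 2 ≤ (R.vertsOf (C : Set R.Face)).ncard := by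
      obtain ⟨d, rfl⟩ := R.face_surjective f₀
      have hsub : ({d.fst, d.snd} : Set V) ⊆ R.vertsOf (C : Set R.Face) := by
        rintro v (rfl | rfl)
        · exact ⟨d, rfl, hf₀⟩
        · exact ⟨R.facePerm d, R.facePerm_fst d, by rw [R.face_facePerm]; exact hf₀⟩
      rw [← Set.ncard_pair d.adj.ne]
      exact Set.ncard_le_ncard hsub (Set.toFinite _)
    have h3 := hG.ncard_le_of_subset_spannedEdges (R.edgesOf_subset_spannedEdges _) hall h2
    omega

end Hall
-- From Hall's condition to matchings and labelings
section Matching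

variable {V : Type u} {G : SimpleGraph V}

/-- Two faces of `N` are linked if they share an edge. -/
def RotationSystem.Linked (R : RotationSystem G) (N : Set R.Face) (f g : R.Face) : Prop :=
  ∃ d : G.Dart, R.face d = f ∧ R.face d.symm = g ∧ f ∈ N ∧ g ∈ N

theorem RotationSystem.dualConnected_class (R : RotationSystem G) (N : Set R.Face)
    (K : Quotient (Relation.EqvGen.setoid (R.Linked N))) :
    R.DualConnected {f | f ∈ N ∧ (Quotient.mk _ f : Quotient _) = K} := by
  intro P hP f hf g hg hPf
  -- Class membership is carried along with `P` so that every link crossed stays in the class; an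
  -- equivalence is needed for the symmetry case.
  have key : ∀ f g : R.Face, Relation.EqvGen (R.Linked N) f g →
      (((f ∈ N ∧ (Quotient.mk (Relation.EqvGen.setoid (R.Linked N)) f) = K) ∧ P f) ↔
        ((g ∈ N ∧ (Quotient.mk (Relation.EqvGen.setoid (R.Linked N)) g) = K) ∧ P g)) := by
    intro f g h
    induction h with
    | rel f g h =>
      have hfg : (Quotient.mk (Relation.EqvGen.setoid (R.Linked N)) f) = Quotient.mk _ g :=
        Quotient.sound (Relation.EqvGen.rel _ _ h)
      obtain ⟨d, rfl, rfl, h1, h2⟩ := h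
      constructor
      · rintro ⟨⟨_, h3⟩, h4⟩
        have h5 := hfg.symm.trans h3
        exact ⟨⟨h2, h5⟩, hP d ⟨h1, h3⟩ ⟨h2, h5⟩ h4⟩
      · rintro ⟨⟨_, h3⟩, h4⟩
        have h5 := hfg.trans h3
        refine ⟨⟨h1, h5⟩, ?_⟩
        have := hP d.symm ⟨h2, h3⟩ (by rw [d.symm_symm]; exact ⟨h1, h5⟩) h4
        rwa [d.symm_symm] at this
    | refl f => rfl
    | symm f g _ ih => exact ih.symm
    | trans f g h _ _ ih1 ih2 => exact ih1.trans ih2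
  exact ((key f g (Quotient.exact (hf.2.trans hg.2.symm))).1 ⟨hf, hPf⟩).2

theorem exists_isPerfectMatching (R : RotationSystem G) (outer : R.Face) (v₀ : V)
    {φ : {v : V // v ≠ v₀} → FaceCopy R outer} (hφ : Function.Bijective φ)
    (hinc : ∀ v, R.Incident v.1 (φ v).1) :
    ∃ P : (bipartiteH R outer v₀).Subgraph, P.IsPerfectMatching := by
  refine ⟨{
    verts := Set.univ
    Adj := fun x y => (∃ v, x = Sum.inl v ∧ y = Sum.inr (φ v)) ∨
      ∃ v, y = Sum.inl v ∧ x = Sum.inr (φ v)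
    adj_sub := ?_
    edge_vert := fun _ => Set.mem_univ _
    symm := ⟨fun x y h => h.symm⟩ }, SimpleGraph.Subgraph.isPerfectMatching_iff.2 ?_⟩
  · rintro x y (⟨v, rfl, rfl⟩ | ⟨v, rfl, rfl⟩) <;> exact hinc v
  · rintro (v | w)
    · refine ⟨Sum.inr (φ v), Or.inl ⟨v, rfl, rfl⟩, ?_⟩
      rintro y (⟨v', h, rfl⟩ | ⟨v', -, h⟩)
      · rw [Sum.inl.inj h]
      · exact absurd h (by simp)
    · obtain ⟨v, rfl⟩ := hφ.2 w
      refine ⟨Sum.inl v, Or.inr ⟨v, rfl, rfl⟩, ?_⟩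
      rintro y (⟨v', h, -⟩ | ⟨v', rfl, h⟩)
      · exact absurd h (by simp)
      · rw [hφ.1 (Sum.inr.inj h)]

variable [Finite V]

-- Consecutive angles at a vertex of `s` lie in faces sharing an edge, so all faces at that vertex
-- are in one linked class. Splitting both sides by class reduces the inequality to the
-- dual-connected case.
open Classical in
theorem card_le_sum_faceMultiplicity (R : RotationSystem G) [Fintype R.Face]
    (hc : G.Connected) (hF : Nat.card R.Face = Nat.card V) (hG : IsRigidityCircuit G)
    (outer : R.Face) (v₀ : V) (hv₀ : ¬ R.Incident v₀ outer) (s : Finset {v : V // v ≠ v₀}) :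
    s.card ≤ ∑ f with ∃ v ∈ s, R.Incident v.1 f, faceMultiplicity R outer f := by
  set N : Finset R.Face := Finset.univ.filter fun f => ∃ v ∈ s, R.Incident v.1 f with hN
  have hmem : ∀ v ∈ s, ∀ d : G.Dart, d.fst = v.1 → R.face d ∈ N := fun v hv d hd =>
    Finset.mem_filter.2 ⟨Finset.mem_univ _, v, hv, d, hd, rfl⟩
  let κ : R.Face → Quotient (Relation.EqvGen.setoid (R.Linked (N : Set R.Face))) := Quotient.mk _
  have : Finite (Quotient (Relation.EqvGen.setoid (R.Linked (N : Set R.Face)))) :=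
    Quotient.finite _
  have := Fintype.ofFinite (Quotient (Relation.EqvGen.setoid (R.Linked (N : Set R.Face))))
  choose δ hδ using hG.exists_dart hc
  rw [← Finset.sum_fiberwise N κ, Finset.card_eq_sum_card_fiberwise (t := Finset.univ)
    (f := fun v : {v : V // v ≠ v₀} => κ (R.face (δ v.1))) (fun _ _ => Finset.mem_coe.2
      (Finset.mem_univ _))]
  refine Finset.sum_le_sum fun K _ => ?_
  rcases Finset.eq_empty_or_nonempty (s.filter fun v => κ (R.face (δ v.1)) = K) with he | ⟨w, hw⟩
  · rw [he]; exact Nat.zero_le _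
  obtain ⟨hws, hwK⟩ := Finset.mem_filter.1 hw
  have hset : ((N.filter fun f => κ f = K : Finset R.Face) : Set R.Face) =
      {f | f ∈ (N : Set R.Face) ∧ (Quotient.mk _ f : Quotient _) = K} := by
    ext f; simp [κ]
  refine le_trans ?_ (ncard_interiorVerts_le_sum_faceMultiplicity R hc hF hG outer v₀ hv₀
    (N.filter fun f => κ f = K) ⟨_, Finset.mem_filter.2 ⟨hmem w hws _ (hδ _), hwK⟩⟩
    (by rw [hset]; exact R.dualConnected_class _ K))
  rw [← Finset.card_map (Function.Embedding.subtype _), ← Set.ncard_coe_finset]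
  refine Set.ncard_le_ncard ?_ (Set.toFinite _)
  intro x hx
  obtain ⟨v, hv, rfl⟩ := Finset.mem_map.1 (Finset.mem_coe.1 hx)
  obtain ⟨hvs, hvK⟩ := Finset.mem_filter.1 hv
  refine ⟨fun d hd => Finset.mem_coe.2 (Finset.mem_filter.2 ⟨hmem v hvs d hd, ?_⟩), v.2⟩
  refine (R.rot_induction (P := fun e => e.fst = v.1 ∧ κ (R.face e) = K) (fun e he => ?_)
    ((hδ v.1).trans hd.symm) ⟨hδ v.1, hvK⟩).2
  have hfst := (R.rot_fst e).trans he.1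
  refine ⟨hfst, Eq.trans (Quotient.sound (Relation.EqvGen.rel _ _ ?_)) he.2⟩
  exact ⟨R.rot e, rfl, R.face_rot_symm e, hmem v hvs _ hfst, hmem v hvs _ he.1⟩

/-- The face degrees sum to 2(2n - 2), and three is subtracted for each of the n - 1 interior faces,
leaving n - 1. -/
theorem card_faceCopy (R : RotationSystem G) (hc : G.Connected)
    (hF : Nat.card R.Face = Nat.card V) (hG : IsRigidityCircuit G) (outer : R.Face) :
    Nat.card (FaceCopy R outer) + 1 = Nat.card V := by
  classical
  have := Fintype.ofFinite R.Face
  have h : ∀ f : R.Face, R.faceDegree f + (if f = outer then 3 else 0) =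
      faceMultiplicity R outer f + 3 := by
    intro f
    have := hG.three_le_faceDegree hc R f
    unfold faceMultiplicity
    split_ifs <;> omega
  have hsum := Finset.sum_congr (rfl : (Finset.univ : Finset R.Face) = Finset.univ) fun f _ => h f
  rw [Finset.sum_add_distrib, Finset.sum_add_distrib, Finset.sum_const, smul_eq_mul,
    Finset.sum_ite_eq', if_pos (Finset.mem_univ _), R.sum_faceDegree, Finset.card_univ,
    ← Nat.card_eq_fintype_card] at hsum
  have hdarts : {d : G.Dart | R.face d ∈ (Finset.univ : Finset R.Face)} =
      {d : G.Dart | d.edge ∈ G.edgeSet} := by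
    ext d; simp
  rw [hdarts, RotationSystem.ncard_darts_of_edges subset_rfl] at hsum
  have hE := hG.ncard_edgeSet
  have hcard : Nat.card (FaceCopy R outer) = ∑ f, faceMultiplicity R outer f := by
    simp [Nat.card_eq_fintype_card, FaceCopy]
  omega

theorem exists_bijective_incident (R : RotationSystem G) (hc : G.Connected)
    (hF : Nat.card R.Face = Nat.card V) (hG : IsRigidityCircuit G) (outer : R.Face) (v₀ : V)
    (hv₀ : ¬ R.Incident v₀ outer) :
    ∃ φ : {v : V // v ≠ v₀} → FaceCopy R outer,
      Function.Bijective φ ∧ ∀ v, R.Incident v.1 (φ v).1 := by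
  classical
  have := Fintype.ofFinite R.Face
  let t : {v : V // v ≠ v₀} → Finset (FaceCopy R outer) := fun v =>
    (Finset.univ.filter fun f => R.Incident v.1 f).sigma fun _ => Finset.univ
  have hall : ∀ s : Finset {v : V // v ≠ v₀}, s.card ≤ (s.biUnion t).card := by
    intro s
    have heq : s.biUnion t =
        (Finset.univ.filter fun f => ∃ v ∈ s, R.Incident v.1 f).sigma fun _ => Finset.univ := by
      ext x
      simp [t]
    rw [heq, Finset.card_sigma]
    simpa using card_le_sum_faceMultiplicity R hc hF hG outer v₀ hv₀ s
  obtain ⟨φ, hinj, hφ⟩ := (Finset.all_card_le_biUnion_card_iff_exists_injective t).1 hall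
  refine ⟨φ, hinj.bijective_of_nat_card_le ?_, fun v => ?_⟩
  · have h1 := card_faceCopy R hc hF hG outer
    have h2 : Nat.card {v : V // v ≠ v₀} = Nat.card V - 1 := by
      rw [← Set.ncard_singleton v₀, ← Set.ncard_compl]; rfl
    omega
  · simpa [t] using hφ v

/-- The labeling that makes the chosen angle at every vertex other than `v₀` big. -/
theorem exists_isPointedPlusOneCPT (R : RotationSystem G) (hc : G.Connected)
    (hG : IsRigidityCircuit G) (outer : R.Face) (v₀ : V)
    {φ : {v : V // v ≠ v₀} → FaceCopy R outer} (hφ : Function.Bijective φ)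
    (hinc : ∀ v, R.Incident v.1 (φ v).1) :
    ∃ L : G.Dart → AngleLabel, IsPointedPlusOneCPT R outer L ∧ ¬ IsPointed L v₀ := by
  classical
  choose δ hδ hface using hinc
  let L : G.Dart → AngleLabel := fun d => if ∃ v, δ v = d then AngleLabel.big else AngleLabel.small
  have hbig : ∀ d, L d = AngleLabel.big ↔ ∃ v, δ v = d := fun d => by simp [L]
  have hsmall : ∀ d, L d = AngleLabel.small ↔ ¬ ∃ v, δ v = d := fun d => by simp [L]
  have hinj : Function.Injective δ := fun v w h =>
    Subtype.ext ((hδ v).symm.trans ((congrArg (fun d : G.Dart => d.fst) h).trans (hδ w)))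
  -- The big angles in `f` correspond to the copies of `f`, by bijectivity of `φ`.
  have hcount : ∀ f : R.Face, {d : G.Dart | R.face d = f ∧ L d = AngleLabel.big}.ncard =
      faceMultiplicity R outer f := by
    intro f
    choose ψ hψ using hφ.2
    have heq : {d : G.Dart | R.face d = f ∧ L d = AngleLabel.big} =
        Set.range fun i : Fin (faceMultiplicity R outer f) => δ (ψ ⟨f, i⟩) := by
      ext d
      constructor
      · rintro ⟨rfl, hd⟩
        obtain ⟨v, rfl⟩ := (hbig d).1 hd
        have hv : φ v = ⟨R.face (δ v), (hface v).symm ▸ (φ v).2⟩ := by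
          refine Sigma.ext (hface v).symm ?_
          simp
        refine ⟨(hface v).symm ▸ (φ v).2, congrArg δ (hφ.1 ?_)⟩
        rw [hψ]; exact hv.symm
      · rintro ⟨i, rfl⟩
        refine ⟨?_, (hbig _).2 ⟨_, rfl⟩⟩
        rw [hface, hψ]
    rw [heq, ← Set.image_univ, Set.ncard_image_of_injective, Set.ncard_univ, Nat.card_eq_fintype_card,
      Fintype.card_fin]
    intro i j h
    have h1 := congrArg φ (hinj h)
    rw [hψ, hψ] at h1
    exact eq_of_heq (Sigma.mk.inj h1).2
  have hsplit : ∀ f : R.Face, {d : G.Dart | R.face d = f ∧ L d = AngleLabel.small}.ncard +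
      faceMultiplicity R outer f = R.faceDegree f := by
    intro f
    rw [← hcount f, RotationSystem.faceDegree, ← Set.ncard_union_eq]
    · congr 1
      ext d
      simp only [Set.mem_union, Set.mem_ofPred_eq, hbig, hsmall]
      tauto
    · rw [Set.disjoint_left]
      rintro d ⟨-, h1⟩ ⟨-, h2⟩
      exact absurd (h1.symm.trans h2) (by simp)
  have hnot : ¬ IsPointed L v₀ := by
    rintro ⟨d, hd₀, hd⟩
    obtain ⟨v, rfl⟩ := (hbig d).1 hd
    exact v.2 ((hδ v).symm.trans hd₀)
  have hpt : ∀ v, v ≠ v₀ → IsPointed L v := fun v hv =>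
    ⟨δ ⟨v, hv⟩, hδ _, (hbig _).2 ⟨_, rfl⟩⟩
  refine ⟨L, ⟨⟨?_, ?_, ?_, ?_⟩, v₀, hnot, ?_⟩, hnot⟩
  · intro f hf
    have h1 := hsplit f
    have h2 := hG.three_le_faceDegree hc R f
    rw [faceMultiplicity, if_neg hf] at h1
    omega
  · intro d hd
    have h1 := hsplit outer
    rw [faceMultiplicity, if_pos rfl, Nat.add_eq_right, Set.ncard_eq_zero (Set.toFinite _),
      Set.eq_empty_iff_forall_notMem] at h1
    rw [hbig]
    by_contra hn
    exact h1 d ⟨hd, (hsmall d).2 hn⟩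
  · intro d d' h hd hd'
    obtain ⟨v, rfl⟩ := (hbig d).1 hd
    obtain ⟨w, rfl⟩ := (hbig d').1 hd'
    rw [hδ, hδ] at h
    rw [Subtype.ext h]
  · intro v hv
    have := hG.three_le_ncard_neighborSet hc v
    omega
  · intro v hv
    by_contra h
    exact hv (hpt v h)

end Matching

end PseudoTri

theorem mainTheorem9 {V : Type u} [Finite V] (G : SimpleGraph V)
    (hG : PseudoTri.IsRigidityCircuit G) (M : PseudoTri.SphereEmbedding G)
    (outer : M.toRotationSystem.Face) (v₀ : V)
    (hv₀ : ¬ M.toRotationSystem.Incident v₀ outer) :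
    (∃ P : (PseudoTri.bipartiteH M.toRotationSystem outer v₀).Subgraph, P.IsPerfectMatching) ∧
      ∃ L : G.Dart → PseudoTri.AngleLabel,
        PseudoTri.IsPointedPlusOneCPT M.toRotationSystem outer L ∧
          ¬ PseudoTri.IsPointed L v₀ := by
  obtain ⟨φ, hφ, hinc⟩ := PseudoTri.exists_bijective_incident M.toRotationSystem M.connected
    (M.card_face hG) hG outer v₀ hv₀
  exact ⟨PseudoTri.exists_isPerfectMatching _ outer v₀ hφ hinc,
    PseudoTri.exists_isPointedPlusOneCPT _ M.connected hG outer v₀ hφ hinc⟩
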